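/- Fix an integer $n \ge 0$. For a field $F$ and a set $S \subseteq M_n(F)$ of $n\times n$ matrices, let $N(S)$ be the set of polynomials $f = \sum_i B_i x^i \in M_n(F)[x]$ (where $x$ is a central indeterminate) such that $f(A) := \sum_i B_i A^i = 0$ for all $A \in S$. Call $S$ a core set if $N(S)$ is a two-sided ideal of $M_n(F)[x]$, and a pure core set if $S \cap \mathcal{C}$ is a core set for every similarity class $\mathcal{C} \subseteq M_n(F)$. For a prime $q$, let $S$ be a subset of $M_n(\mathbb{F}_q)$ chosen uniformly at random among all subsets of $M_n(\mathbb{F}_q)$. Then, as $q \to \infty$ through the primes, $$\lim_{q\to\infty} \mathbb{P}(S \text{ is a pure core set}) = \lim_{q\to\infty} \mathbb{P}(S \text{ is a core set}) = 1 .$$ -/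

import Mathlib

open Polynomial Filter Topology
open scoped ENNReal

/-- The zero ideal `N(S)` of a set `S` of `n × n` matrices: the polynomials with matrix coefficients
that vanish at every element of `S`.  The indeterminate is central, and `Polynomial.eval A f` is
`∑ i, f.coeff i * A ^ i`, i.e. powers of `A` are placed to the right of the coefficients. -/
def matrixZeroIdeal {n : ℕ} {F : Type*} [Field F] (S : Set (Matrix (Fin n) (Fin n) F)) :
    Set (Polynomial (Matrix (Fin n) (Fin n) F)) :=
  {f | ∀ A ∈ S, f.eval A = 0}

/-- `S` is a core set if `N(S)` is a two-sided ideal of the polynomial ring over matrices. -/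
def IsCoreSet {n : ℕ} {F : Type*} [Field F] (S : Set (Matrix (Fin n) (Fin n) F)) : Prop :=
  ∃ I : TwoSidedIdeal (Polynomial (Matrix (Fin n) (Fin n) F)),
    (I : Set (Polynomial (Matrix (Fin n) (Fin n) F))) = matrixZeroIdeal S

/-- `S` is a pure core set if its intersection with every similarity class is a core set.  The
similarity classes are the conjugacy classes of the multiplicative monoid of matrices (conjugation
by units). -/
def IsPureCoreSet {n : ℕ} {F : Type*} [Field F] (S : Set (Matrix (Fin n) (Fin n) F)) : Prop :=
  ∀ C : ConjClasses (Matrix (Fin n) (Fin n) F), IsCoreSet (S ∩ C.carrier)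

/-- The probability that a uniformly random subset of the finite set of `n × n` matrices over the
field `ℤ/q`, with `q` prime, has the property `P`. -/
noncomputable def randomSubsetProb (n : ℕ) (q : ℕ) [Fact q.Prime]
    (P : Set (Matrix (Fin n) (Fin n) (ZMod q)) → Prop) : ℝ≥0∞ :=
  (PMF.uniformOfFintype (Set (Matrix (Fin n) (Fin n) (ZMod q)))).toOuterMeasure {S | P S}

/-! ### Evaluation at matrices and two-sidedness of null ideals. -/

section CoreSets

variable {n : ℕ} {F : Type*} [Field F]

local notation "Mat" => Matrix (Fin n) (Fin n) F

/-! A whole nonscalar similarity class is a core set (`isCoreSet_conjClass`), so its intersection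
with `S` is core as soon as both have the same null ideal. Modulo the characteristic polynomial only
polynomials of degree `< n` matter. If such a polynomial is nonzero somewhere on the class, it is
nonzero at `q - 1` or more points (`card_sub_one_le_ncard_similarNonzeroSet`), all missed by a
random `S` with probability at most `2⁻¹ ^ (q - 1)`. There are only polynomially many (in `q`) pairs
of a matrix and a polynomial, so a union bound finishes. -/

theorem eval_mul_eq_zero_of_eval_right {R : Type*} [Semiring R] {a : R} {f : R[X]}
    (hf : f.eval a = 0) (g : R[X]) : (g * f).eval a = 0 := by
  induction g using Polynomial.induction_on' with
  | add p q hp hq => rw [add_mul, eval_add, hp, hq, add_zero]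
  | monomial k b =>
    rw [← C_mul_X_pow_eq_monomial, mul_assoc, eval_C_mul, X_pow_mul, eval_mul_X_pow, hf,
      zero_mul, mul_zero]

theorem eval_mul_C_of_inverse {R : Type*} [Semiring R] {u v : R} (h : v * u = 1) (a : R)
    (f : R[X]) : (f * C u).eval a = f.eval (u * a * v) * u := by
  induction f using Polynomial.induction_on' with
  | add p q hp hq => rw [add_mul, eval_add, hp, hq, eval_add, add_mul]
  | monomial k b =>
    have key : ∀ k : ℕ, (u * a * v) ^ k * u = u * a ^ k := by
      intro k
      induction k with
      | zero => simp
      | succ k ih =>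
        rw [pow_succ, mul_assoc, mul_assoc (u * a), h, mul_one, ← mul_assoc, ih, mul_assoc,
          pow_succ]
    rw [monomial_mul_C, eval_monomial, eval_monomial, mul_assoc, mul_assoc, key]

theorem commute_map_algebraMap {R A : Type*} [CommSemiring R] [Semiring A] [Algebra R A]
    (p : R[X]) (f : A[X]) : Commute (p.map (algebraMap R A)) f := by
  induction p using Polynomial.induction_on' with
  | add p q hp hq => rw [Polynomial.map_add]; exact hp.add_left hq
  | monomial k r =>
    rw [map_monomial, ← C_mul_X_pow_eq_monomial]
    refine Commute.mul_left ?_ (commute_X_pow f k)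
    ext i
    rw [coeff_C_mul, coeff_mul_C, Algebra.commutes]

/-- `N(S)` is always a left ideal and `X` is central, so only right multiplication by constants can
fail. -/
theorem isCoreSet_of_mul_C_mem {S : Set Mat}
    (h : ∀ f ∈ matrixZeroIdeal S, ∀ M : Mat, f * C M ∈ matrixZeroIdeal S) : IsCoreSet S := by
  have hadd : ∀ {f g : Mat[X]}, f ∈ matrixZeroIdeal S → g ∈ matrixZeroIdeal S →
      f + g ∈ matrixZeroIdeal S := fun hf hg A hA => by
    rw [eval_add, hf A hA, hg A hA, add_zero]
  have hleft : ∀ {g f : Mat[X]}, f ∈ matrixZeroIdeal S → g * f ∈ matrixZeroIdeal S :=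
    fun hf A hA => eval_mul_eq_zero_of_eval_right (hf A hA) _
  refine ⟨TwoSidedIdeal.mk' (matrixZeroIdeal S) (fun A _ => eval_zero) hadd
    (fun hf A hA => by rw [eval_neg, hf A hA, neg_zero]) hleft ?_, TwoSidedIdeal.coe_mk' ..⟩
  intro f g hf
  induction g using Polynomial.induction_on' with
  | add p q hp hq => rw [mul_add]; exact hadd hp hq
  | monomial k M =>
    rw [← C_mul_X_pow_eq_monomial, ← mul_assoc, ← X_pow_mul]
    exact hleft (h f hf M)

theorem matrixZeroIdeal_iUnion {ι : Sort*} (S : ι → Set Mat) :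
    matrixZeroIdeal (⋃ i, S i) = ⋂ i, matrixZeroIdeal (S i) := by
  ext f
  simp only [matrixZeroIdeal, Set.mem_iUnion, Set.mem_iInter, Set.mem_ofPred_eq]
  exact ⟨fun h i A hA => h A ⟨i, hA⟩, fun h A ⟨i, hA⟩ => h i A hA⟩

theorem IsCoreSet.mul_mem {S : Set Mat} (hS : IsCoreSet S) {f : Mat[X]}
    (hf : f ∈ matrixZeroIdeal S) (g : Mat[X]) : f * g ∈ matrixZeroIdeal S := by
  obtain ⟨I, hI⟩ := hS
  rw [← hI] at hf ⊢
  exact I.mul_mem_right f g hf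

theorem IsPureCoreSet.isCoreSet {S : Set Mat} (hS : IsPureCoreSet S) : IsCoreSet S := by
  have hU : S = ⋃ K : ConjClasses Mat, S ∩ K.carrier := by
    ext A
    simp only [Set.mem_iUnion, Set.mem_inter_iff, exists_and_left]
    exact ⟨fun h => ⟨h, ConjClasses.mk A, ConjClasses.mem_carrier_mk⟩, fun h => h.1⟩
  rw [hU]
  refine isCoreSet_of_mul_C_mem fun f hf M => ?_
  rw [matrixZeroIdeal_iUnion] at hf ⊢
  rw [Set.mem_iInter] at hf ⊢
  exact fun K => (hS K).mul_mem (hf K) _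

/-- Evaluation at a central matrix commutes with right multiplication by constants. -/
theorem isCoreSet_of_subset_singleton_scalar {S : Set Mat} {r : F}
    (hS : S ⊆ {Matrix.scalar (Fin n) r}) : IsCoreSet S := by
  refine isCoreSet_of_mul_C_mem fun f hf M A hA => ?_
  have hc : Commute M A := by
    rw [hS hA]
    exact (Matrix.scalar_commute r (fun _ => Commute.all _ _) M).symm
  have key : ∀ f : Mat[X], (f * C M).eval A = f.eval A * M := by
    intro f
    induction f using Polynomial.induction_on' with
    | add p q hp hq => rw [add_mul, eval_add, hp, hq, eval_add, add_mul]
    | monomial k b =>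
      rw [monomial_mul_C, eval_monomial, eval_monomial, mul_assoc, mul_assoc,
        (hc.pow_right k).eq]
  rw [key, hf A hA, zero_mul]

theorem IsConj.exists_units_eq {M : Type*} [Monoid M] {a b : M} (h : IsConj a b) :
    ∃ u : Mˣ, b = u * a * ((u⁻¹ : Mˣ) : M) := by
  obtain ⟨u, hu⟩ := h
  exact ⟨u, by rw [hu.eq, mul_assoc, Units.mul_inv, mul_one]⟩

theorem isConj_transvection_conj {i j : Fin n} (hij : i ≠ j) (t : F) (A : Mat) :
    IsConj A (Matrix.transvection i j t * A * Matrix.transvection i j (-t)) := by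
  have h : ∀ c : F, Matrix.transvection i j c * Matrix.transvection i j (-c) = 1 := fun c => by
    rw [Matrix.transvection_mul_transvection_same i j hij, add_neg_cancel,
      Matrix.transvection_zero]
  have h' : Matrix.transvection i j (-t) * Matrix.transvection i j t = 1 := by simpa using h (-t)
  refine ⟨⟨_, _, h t, h'⟩, ?_⟩
  rw [SemiconjBy, mul_assoc (_ * A), h', mul_one]

/-- Right multiplication by a unit conjugates the evaluation point, so it preserves the null ideal
of a class. Applying this to a transvection and subtracting `f` yields the off-diagonal matrix
units, over any field. -/
theorem isCoreSet_conjClass {A : Mat} (hA : A ∉ Set.range (Matrix.scalar (Fin n))) :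
    IsCoreSet (ConjClasses.mk A).carrier := by
  refine isCoreSet_of_mul_C_mem ?_
  set N := matrixZeroIdeal (ConjClasses.mk A).carrier with hN
  have hadd : ∀ {f g : Mat[X]}, f ∈ N → g ∈ N → f + g ∈ N := fun hf hg A hA => by
    rw [eval_add, hf A hA, hg A hA, add_zero]
  have hoff : ∀ f ∈ N, ∀ i j, i ≠ j → ∀ x : F, f * C (Matrix.single i j x) ∈ N := by
    intro f hf i j hij x B hB
    have h1 : (f * C (Matrix.transvection i j x)).eval B = 0 := by
      have h : Matrix.transvection i j (-x) * Matrix.transvection i j x = 1 := by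
        rw [Matrix.transvection_mul_transvection_same i j hij, neg_add_cancel,
          Matrix.transvection_zero]
      rw [eval_mul_C_of_inverse h, hf _ ?_, zero_mul]
      rw [ConjClasses.mem_carrier_iff_mk_eq, ConjClasses.mk_eq_mk_iff_isConj] at hB ⊢
      exact (isConj_transvection_conj hij x B).symm.trans hB
    rw [Matrix.transvection, C_add, C_1, mul_add, mul_one, eval_add, hf B hB, zero_add] at h1
    exact h1
  -- A nonscalar matrix forces `n ≥ 2`, so a diagonal unit factors through two off-diagonal ones.
  obtain ⟨a, b, hab⟩ : ∃ a b : Fin n, a ≠ b := by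
    by_contra! h
    exact hA (Matrix.mem_range_scalar_of_commute_single fun i j hij => absurd (h i j) hij)
  intro f hf M
  induction M using Matrix.induction_on' with
  | h_zero => rw [C_0, mul_zero]; exact fun _ _ => eval_zero
  | h_add p q hp hq => rw [C_add, mul_add]; exact hadd hp hq
  | h_std_basis i j x =>
    by_cases hij : i = j
    · subst hij
      obtain ⟨k, hk⟩ : ∃ k, k ≠ i := by
        by_cases ha : a = i
        · exact ⟨b, fun hb => hab (ha.trans hb.symm)⟩
        · exact ⟨a, ha⟩
      rw [show Matrix.single i i x = Matrix.single i k x * Matrix.single k i (1 : F) by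
        rw [Matrix.single_mul_single_same, mul_one], C_mul, ← mul_assoc]
      exact hoff _ (hoff f hf i k hk.symm x) k i hk 1
    · exact hoff f hf i j hij x

/-! ### Nonvanishing of polynomials on a similarity class. -/

/-- The matrices similar to `A` at which the polynomial with coefficients `c` does not vanish. -/
def similarNonzeroSet (A : Mat) (c : Fin n → Mat) : Set Mat :=
  {B | IsConj A B ∧ (∑ i, C (c i) * X ^ (i : ℕ)).eval B ≠ 0}

/-- The characteristic polynomial is central in `Mat[X]` and kills the whole class, so the remainder
on division by it has the same values there. -/
theorem exists_coeff_eval_eq_of_isConj (A : Mat) (f : Mat[X]) :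
    ∃ c : Fin n → Mat, ∀ B, IsConj A B → f.eval B = (∑ i, C (c i) * X ^ (i : ℕ)).eval B := by
  rcases n.eq_zero_or_pos with rfl | hn
  · exact ⟨0, fun B _ => Subsingleton.elim _ _⟩
  have : Nonempty (Fin n) := ⟨⟨0, hn⟩⟩
  set p : Mat[X] := A.charpoly.map (algebraMap F Mat) with hp
  have hpm : p.Monic := A.charpoly_monic.map _
  have hpd : p.natDegree = n := by
    rw [hp, A.charpoly_monic.natDegree_map, Matrix.charpoly_natDegree_eq_dim, Fintype.card_fin]
  have hdeg : (f %ₘ p).natDegree < n := by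
    have h := natDegree_modByMonic_lt f hpm (fun h => by
      rw [h, natDegree_one] at hpd; omega)
    rwa [hpd] at h
  refine ⟨fun i => (f %ₘ p).coeff i, fun B hB => ?_⟩
  have hpB : p.eval B = 0 := by
    obtain ⟨u, rfl⟩ := hB.exists_units_eq
    rw [hp, eval_map_algebraMap, ← Matrix.charpoly_units_conj u A, ← Matrix.coe_units_inv]
    exact Matrix.aeval_self_charpoly ((u : Mat) * A * ((u⁻¹ : Matˣ) : Mat))
  have h := modByMonic_add_div f p
  rw [(commute_map_algebraMap A.charpoly (f /ₘ p)).eq] at h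
  have h2 := congrArg (eval B) h
  rw [eval_add, eval_mul_eq_zero_of_eval_right hpB, add_zero] at h2
  rw [← h2, eval_eq_sum_range' hdeg, Finset.sum_range, eval_finsetSum]
  exact Finset.sum_congr rfl fun i _ => by rw [eval_C_mul, eval_X_pow]

theorem isCoreSet_inter_conjClass {A : Mat} (hA : A ∉ Set.range (Matrix.scalar (Fin n)))
    {S : Set Mat} (hS : ∀ c : Fin n → Mat, (similarNonzeroSet A c).Nonempty →
      ¬ Disjoint S (similarNonzeroSet A c)) :
    IsCoreSet (S ∩ (ConjClasses.mk A).carrier) := by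
  have hmem : ∀ B, B ∈ (ConjClasses.mk A).carrier ↔ IsConj A B := fun B => by
    rw [ConjClasses.mem_carrier_iff_mk_eq, ConjClasses.mk_eq_mk_iff_isConj, isConj_comm]
  suffices h : matrixZeroIdeal (S ∩ (ConjClasses.mk A).carrier) =
      matrixZeroIdeal (ConjClasses.mk A).carrier by
    obtain ⟨I, hI⟩ := isCoreSet_conjClass hA
    exact ⟨I, hI.trans h.symm⟩
  refine Set.Subset.antisymm (fun f hf => ?_) fun f hf B hB => hf B hB.2
  obtain ⟨c, hc⟩ := exists_coeff_eval_eq_of_isConj A f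
  by_contra hnot
  obtain ⟨B, hB, hfB⟩ : ∃ B ∈ (ConjClasses.mk A).carrier, f.eval B ≠ 0 := by
    by_contra! h
    exact hnot h
  rw [hmem] at hB
  obtain ⟨D, hDS, hD⟩ := Set.not_disjoint_iff.1 (hS c ⟨B, hB, by rwa [← hc B hB]⟩)
  exact hD.2 (by rw [← hc D hD.1]; exact hf D ⟨hDS, (hmem D).2 hD.1⟩)

theorem isPureCoreSet_of_not_disjoint {S : Set Mat}
    (hS : ∀ A ∉ Set.range (Matrix.scalar (Fin n)), ∀ c : Fin n → Mat,
      (similarNonzeroSet A c).Nonempty → ¬ Disjoint S (similarNonzeroSet A c)) :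
    IsPureCoreSet S := by
  intro K
  obtain ⟨A, rfl⟩ := ConjClasses.exists_rep K
  by_cases hA : A ∈ Set.range (Matrix.scalar (Fin n))
  · obtain ⟨r, rfl⟩ := hA
    refine isCoreSet_of_subset_singleton_scalar (r := r) ?_
    rintro B ⟨-, hB⟩
    rw [ConjClasses.mem_carrier_iff_mk_eq, ConjClasses.mk_eq_mk_iff_isConj, isConj_comm] at hB
    obtain ⟨u, rfl⟩ := hB.exists_units_eq
    rw [← (Matrix.scalar_commute r (fun _ => Commute.all _ _) (u : Mat)).eq, mul_assoc,
      Units.mul_inv, mul_one]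
    rfl
  · exact isCoreSet_inter_conjClass hA (hS A hA)

theorem IsConj.notMem_range_scalar {A B : Mat} (h : IsConj A B)
    (hA : A ∉ Set.range (Matrix.scalar (Fin n))) : B ∉ Set.range (Matrix.scalar (Fin n)) := by
  rintro ⟨r, rfl⟩
  obtain ⟨u, hu⟩ := h.symm.exists_units_eq
  refine hA ⟨r, ?_⟩
  rw [hu, ← (Matrix.scalar_commute r (fun _ => Commute.all _ _) (u : Mat)).eq, mul_assoc,
    Units.mul_inv, mul_one]

/-- Conjugate a nonvanishing point `B` by transvections `T t = 1 + t • E` with `E` not commuting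
with `B`: the conjugates are distinct, and the value of `f` there, times the unit `T t`, is affine
in `t` with nonzero constant term, so it vanishes for at most one `t`. -/
theorem card_sub_one_le_ncard_similarNonzeroSet [Finite F] {A : Mat}
    (hA : A ∉ Set.range (Matrix.scalar (Fin n))) {c : Fin n → Mat}
    (hne : (similarNonzeroSet A c).Nonempty) :
    Nat.card F - 1 ≤ (similarNonzeroSet A c).ncard := by
  obtain ⟨B, hAB, hB⟩ := hne
  have hBs := hAB.notMem_range_scalar hA
  obtain ⟨i, j, hij, hcomm⟩ : ∃ i j : Fin n, i ≠ j ∧ ¬ Commute (Matrix.single i j (1 : F)) B := by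
    by_contra! h
    exact hBs (Matrix.mem_range_scalar_of_commute_single h)
  set f : Mat[X] := ∑ i, C (c i) * X ^ (i : ℕ) with hf
  set E : Mat := Matrix.single i j 1 with hE
  set T : F → Mat := fun t => Matrix.transvection i j t with hT
  have hTadd : ∀ s t, T s * T t = T (s + t) := Matrix.transvection_mul_transvection_same i j hij
  have hT0 : T 0 = 1 := Matrix.transvection_zero i j
  have hTE : ∀ t, T t = 1 + t • E := fun t => by
    simp only [hT, hE, Matrix.transvection, Matrix.smul_single, smul_eq_mul, mul_one]
  have hTinv : ∀ t, T (-t) * T t = 1 := fun t => by rw [hTadd, neg_add_cancel, hT0]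
  have hinj : Function.Injective fun t => T t * B * T (-t) := by
    intro s t hst
    by_contra hne
    have h1 : T (s - t) * B = B * T (s - t) := by
      have := congrArg (fun M => T (-t) * M * T s) hst
      simp only [← mul_assoc, hTadd] at this
      simp only [mul_assoc, hTadd] at this
      simpa [hT0, sub_eq_add_neg, add_comm] using this
    rw [hTE, add_mul, mul_add, one_mul, mul_one, add_right_inj, smul_mul_assoc, mul_smul_comm] at h1
    exact hcomm (smul_right_injective Mat (sub_ne_zero.2 hne) h1)
  have heval : ∀ t, f.eval (T t * B * T (-t)) * T t = f.eval B + t • (f * C E).eval B := by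
    intro t
    rw [← eval_mul_C_of_inverse (hTinv t), hTE, C_add, C_1, mul_add, mul_one, eval_add,
      ← smul_C, mul_smul_comm, eval_smul]
  have hsub : {t : F | f.eval (T t * B * T (-t)) = 0}.Subsingleton := by
    intro s hs t ht
    by_contra hne
    have h1 := heval s
    have h2 := heval t
    rw [Set.mem_ofPred_eq] at hs ht
    rw [hs, zero_mul] at h1
    rw [ht, zero_mul, h1, add_right_inj] at h2
    have h3 : (f * C E).eval B = 0 := by
      by_contra h3
      exact hne (smul_left_injective F h3 h2)
    rw [h3, smul_zero, add_zero] at h1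
    exact hB h1.symm
  have h1 : Nat.card F - 1 ≤ {t : F | f.eval (T t * B * T (-t)) = 0}ᶜ.ncard := by
    have := Set.ncard_add_ncard_compl {t : F | f.eval (T t * B * T (-t)) = 0}
    have := Set.ncard_le_one_iff_subsingleton.2 hsub
    omega
  refine h1.trans ?_
  rw [← Set.ncard_image_of_injective _ hinj]
  refine Set.ncard_le_ncard ?_ (Set.toFinite _)
  rintro _ ⟨t, ht, rfl⟩
  exact ⟨hAB.trans (isConj_transvection_conj hij t B), ht⟩

end CoreSets

/-! ### Probability estimates. -/

theorem uniformOfFintype_toOuterMeasure_disjoint_le {α : Type*} [Fintype α] {Z : Set α} {k : ℕ} (hk : k ≤ Z.ncard) :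
    (PMF.uniformOfFintype (Set α)).toOuterMeasure {S | Disjoint S Z} ≤ (2 : ℝ≥0∞)⁻¹ ^ k := by
  classical
  rw [PMF.toOuterMeasure_uniformOfFintype_apply]
  have h1 : Fintype.card {S : Set α | Disjoint S Z} = 2 ^ Zᶜ.ncard := by
    rw [← Nat.card_eq_fintype_card, ← Set.ncard_powerset, Nat.card_coe_set_eq]
    congr 1
    ext S
    exact Set.subset_compl_iff_disjoint_right.symm
  have h2 : Fintype.card (Set α) = 2 ^ Z.ncard * 2 ^ Zᶜ.ncard := by
    rw [← pow_add, Set.ncard_add_ncard_compl, Nat.card_eq_fintype_card, Fintype.card_set]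
  rw [h1, h2]
  push_cast
  rw [ENNReal.div_eq_inv_mul, ENNReal.mul_inv (by simp) (by simp), mul_assoc,
    ENNReal.inv_mul_cancel (by simp) (by simp), mul_one, ENNReal.inv_pow]
  exact pow_le_pow_right_of_le_one' (ENNReal.inv_le_one.2 one_le_two) hk

theorem one_le_randomSubsetProb_isPureCoreSet_add (n q : ℕ) [Fact q.Prime] :
    1 ≤ randomSubsetProb n q IsPureCoreSet +
      (q : ℝ≥0∞) ^ (n * n + n * n * n) * (2 : ℝ≥0∞)⁻¹ ^ (q - 1) := by
  classical
  set μ := (PMF.uniformOfFintype (Set (Matrix (Fin n) (Fin n) (ZMod q)))).toOuterMeasure with hμ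
  -- The side conditions are part of the event, so irrelevant pairs give the empty event and one
  -- bound serves all pairs.
  let E : Matrix (Fin n) (Fin n) (ZMod q) × (Fin n → Matrix (Fin n) (Fin n) (ZMod q)) →
      Set (Set (Matrix (Fin n) (Fin n) (ZMod q))) := fun x =>
    {S | (x.1 ∉ Set.range (Matrix.scalar (Fin n)) ∧ (similarNonzeroSet x.1 x.2).Nonempty) ∧
      Disjoint S (similarNonzeroSet x.1 x.2)}
  have hE : ∀ x, μ (E x) ≤ (2 : ℝ≥0∞)⁻¹ ^ (q - 1) := by
    intro x
    by_cases hx : x.1 ∉ Set.range (Matrix.scalar (Fin n)) ∧ (similarNonzeroSet x.1 x.2).Nonempty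
    · refine (MeasureTheory.measure_mono fun S hS => hS.2).trans
        (uniformOfFintype_toOuterMeasure_disjoint_le (Z := similarNonzeroSet x.1 x.2) ?_)
      simpa using card_sub_one_le_ncard_similarNonzeroSet hx.1 hx.2
    · rw [show E x = ∅ from Set.eq_empty_of_forall_notMem fun S hS => hx hS.1,
        MeasureTheory.measure_empty]
      exact zero_le
  have hcover : (Set.univ : Set (Set (Matrix (Fin n) (Fin n) (ZMod q)))) ⊆
      {S | IsPureCoreSet S} ∪ ⋃ x, E x := by
    intro S _
    by_cases hS : S ∈ ⋃ x, E x
    · exact Or.inr hS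
    · refine Or.inl (isPureCoreSet_of_not_disjoint fun A hA c hne hd => hS ?_)
      exact Set.mem_iUnion.2 ⟨(A, c), ⟨hA, hne⟩, hd⟩
  have hcard : Fintype.card (Matrix (Fin n) (Fin n) (ZMod q)) = q ^ (n * n) := by
    rw [← Nat.card_eq_fintype_card, Matrix, Nat.card_fun, Nat.card_fun, Nat.card_zmod,
      Nat.card_fin, ← pow_mul]
  have huniv : μ Set.univ = 1 := by
    rw [hμ, PMF.toOuterMeasure_apply_eq_one_iff]
    exact Set.subset_univ _
  calc 1 = μ Set.univ := huniv.symm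
    _ ≤ μ {S | IsPureCoreSet S} + μ (⋃ x, E x) :=
      (MeasureTheory.measure_mono hcover).trans (MeasureTheory.measure_union_le _ _)
    _ ≤ _ := by
      refine add_le_add le_rfl ((MeasureTheory.measure_iUnion_fintype_le μ E).trans ?_)
      refine (Finset.sum_le_card_nsmul _ _ _ fun x _ => hE x).trans_eq ?_
      rw [Finset.card_univ, nsmul_eq_mul, Fintype.card_prod, Fintype.card_fun, hcard, Fintype.card_fin]
      push_cast
      rw [← pow_mul, ← pow_add]

theorem tendsto_natCast_pow_mul_inv_two_pow (k : ℕ) :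
    Tendsto (fun q : ℕ => (q : ℝ≥0∞) ^ k * (2 : ℝ≥0∞)⁻¹ ^ (q - 1)) atTop (𝓝 0) := by
  -- The factor 2 absorbs the shift from exponent `q` to `q - 1`, valid for `q ≥ 1`.
  have h := (tendsto_pow_const_mul_const_pow_of_lt_one k (r := (2 : ℝ)⁻¹) (by norm_num)
    (by norm_num)).const_mul 2
  rw [mul_zero] at h
  have h' := ENNReal.tendsto_ofReal h
  rw [ENNReal.ofReal_zero] at h'
  refine h'.congr' ?_
  filter_upwards [eventually_ge_atTop 1] with q hq
  obtain ⟨m, rfl⟩ := Nat.exists_eq_add_of_le' hq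
  rw [Nat.add_sub_cancel, pow_succ, show (2 : ℝ) * (((m + 1 : ℕ) : ℝ) ^ k * (2⁻¹ ^ m * 2⁻¹)) =
    ((m + 1 : ℕ) : ℝ) ^ k * 2⁻¹ ^ m by ring, ENNReal.ofReal_mul (by positivity),
    ENNReal.ofReal_pow (by positivity), ENNReal.ofReal_pow (by positivity),
    ENNReal.ofReal_natCast, ENNReal.ofReal_inv_of_pos (by norm_num), ENNReal.ofReal_ofNat]

theorem randomSubsetProb_mono (n q : ℕ) [Fact q.Prime]
    {P Q : Set (Matrix (Fin n) (Fin n) (ZMod q)) → Prop} (h : ∀ S, P S → Q S) :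
    randomSubsetProb n q P ≤ randomSubsetProb n q Q :=
  MeasureTheory.measure_mono h

theorem randomSubsetProb_le_one (n q : ℕ) [Fact q.Prime]
    (P : Set (Matrix (Fin n) (Fin n) (ZMod q)) → Prop) : randomSubsetProb n q P ≤ 1 := by
  refine (MeasureTheory.measure_mono (Set.subset_univ _)).trans_eq ?_
  rw [PMF.toOuterMeasure_apply_eq_one_iff]
  exact Set.subset_univ _

theorem theorem7p2 (n : ℕ) :
    Tendsto (fun q : Nat.Primes =>
        haveI : Fact (q : ℕ).Prime := ⟨q.2⟩
        randomSubsetProb n q IsPureCoreSet)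
      (comap ((↑) : Nat.Primes → ℕ) atTop) (𝓝 1) ∧
    Tendsto (fun q : Nat.Primes =>
        haveI : Fact (q : ℕ).Prime := ⟨q.2⟩
        randomSubsetProb n q IsCoreSet)
      (comap ((↑) : Nat.Primes → ℕ) atTop) (𝓝 1) := by
  have hlow : Tendsto (fun q : Nat.Primes =>
      1 - ((q : ℕ) : ℝ≥0∞) ^ (n * n + n * n * n) * (2 : ℝ≥0∞)⁻¹ ^ ((q : ℕ) - 1))
      (comap ((↑) : Nat.Primes → ℕ) atTop) (𝓝 1) := by
    have h := ENNReal.Tendsto.sub (tendsto_const_nhds (x := (1 : ℝ≥0∞)))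
      ((tendsto_natCast_pow_mul_inv_two_pow (n * n + n * n * n)).comp
        (tendsto_comap (f := ((↑) : Nat.Primes → ℕ)))) (Or.inl ENNReal.one_ne_top)
    rwa [tsub_zero] at h
  have hpure : ∀ q : Nat.Primes, haveI : Fact (q : ℕ).Prime := ⟨q.2⟩
      1 - ((q : ℕ) : ℝ≥0∞) ^ (n * n + n * n * n) * (2 : ℝ≥0∞)⁻¹ ^ ((q : ℕ) - 1) ≤
        randomSubsetProb n q IsPureCoreSet := fun q =>
    have : Fact (q : ℕ).Prime := ⟨q.2⟩
    tsub_le_iff_right.2 (one_le_randomSubsetProb_isPureCoreSet_add n q)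
  refine ⟨tendsto_of_tendsto_of_tendsto_of_le_of_le hlow tendsto_const_nhds hpure fun q => ?_,
    tendsto_of_tendsto_of_tendsto_of_le_of_le hlow tendsto_const_nhds
      (fun q => (hpure q).trans ?_) fun q => ?_⟩
  · have : Fact (q : ℕ).Prime := ⟨q.2⟩
    exact randomSubsetProb_le_one n q _
  · have : Fact (q : ℕ).Prime := ⟨q.2⟩
    exact randomSubsetProb_mono n q fun S hS => hS.isCoreSet
  · have : Fact (q : ℕ).Prime := ⟨q.2⟩
    exact randomSubsetProb_le_one n q _
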